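/- Let $\phi=\Pi.\psi$ be a QBF in prenex CNF, with quantifier blocks $\Pi=Q_1X_1\dots Q_nX_n$ and matrix $\psi$; clauses and cubes are sets of literals, and $x<_\Pi y$ means that the block of $x$ lies strictly to the left of that of $y$. For a (possibly partial) assignment $A$, given as the set of literals it makes true, $\phi[A]$ is $\phi$ with all clauses containing a literal of $A$ removed, the complements of the literals of $A$ deleted from the remaining clauses, and the variables of $A$ removed from $\Pi$. The calculus QRES for $\phi$ derives clauses and cubes by the following rules. * (res) From clauses $C_1\cup\{p\}$, $C_2\cup\{\bar p\}$ with $p$ existential (respectively, from cubes $C_1\cup\{p\}$, $C_2\cup\{\bar p\}$ with $p$ universal) derive $C_1\cup C_2$, provided $C_1\cup C_2$ contains no complementary literals, $\bar p\notin C_1$ and $p\notin C_2$. * (red) From a clause $C\cup\{l\}$ with $l$ universal and $l'<_\Pi l$ for all existential $l'\in C$ (respectively, from a cube $C\cup\{l\}$ with $l$ existential and $l'<_\Pi l$ for all universal $l'\in C$) derive $C$, provided $C\cup\{l\}$ contains no complementary literals. * (cl-init) Derive any clause $C\in\psi$ without complementary literals. * (cu-init) Derive the cube $\bigwedge_{l\in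 A}l$ if $A$ is a QCDCL assignment for which the matrix of $\phi[A]$ is empty. Here a QCDCL assignment is an assignment $A=A'\cup A''$ such that every variable to the left of a $\le_\Pi$-maximal variable of the decisions $A'$ is assigned by $A$, and all literals of $A''$ are assigned by a complete run of unit and pure literal detection on $\phi[A']$. The calculus QRES-abs has in addition the axiom * (abs-cl-init) Derive the clause $\bigvee_{l\in A}\bar l$ if $A$ is any assignment of variables of $\phi$ for which $\exists\mathrm{abs}(\phi)[A]$ is unsatisfiable, where $\exists\mathrm{abs}(\phi)=\exists(X_1\cup\dots\cup X_n).\psi$. A refutation of $\phi$ is a sequence of clauses and cubes that contains the empty clause and in which every line follows from earlier lines by a rule. For $t\ge1$ let $\phi_t$ be the formula of Kleine Büning et al. with quantifier prefix $$\exists d_0d_1e_1\,\forall x_1\,\exists d_2e_2\,\forall x_2\,\dots\,\forall x_{t-1}\,\exists d_te_t\,\forall x_t\,\exists f_1\dots f_t$$ and with the clauses * $\bar d_0$ and $d_0\vee\bar d_1\vee\bar e_1$; * $d_j\vee\bar x_j\vee\bar d_{j+1}\vee\bar e_{j+1}$ and $e_j\vee x_j\vee\bar d_{j+1}\vee\bar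 e_{j+1}$ for $1\le j<t$; * $d_t\vee\bar x_t\vee\bar f_1\vee\dots\vee\bar f_t$ and $e_t\vee x_t\vee\bar f_1\vee\dots\vee\bar f_t$; * $x_j\vee f_j$ and $\bar x_j\vee f_j$ for $1\le j\le t$. Then QRES-abs is exponentially stronger than QRES, in the following sense. 1. For every QBF $\phi$ in prenex CNF, every QRES refutation of $\phi$ is also a QRES-abs refutation of $\phi$. 2. There is a polynomial $p$ such that for every $t\ge1$ the formula $\phi_t$ has a QRES-abs refutation whose total size (number of lines plus number of literal occurrences) is at most $p(t)$. Moreover, this refutation can be chosen such that every line that does not follow by a rule of QRES is obtained by abs-cl-init with an assignment $A$ for which $\exists\mathrm{abs}(\phi_t)[A]$ contains two complementary unit clauses $(l)$ and $(\bar l)$, so that the side condition can be checked in polynomial time. 3. There is a constant $c>1$ such that for every $t\ge1$ every QRES refutation of $\phi_t$ has at least $c^t$ lines. -/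

import Mathlib

namespace QBF

/-- The two quantifiers. -/
inductive Quantifier where
  | ex
  | all
  deriving DecidableEq

/-- A literal: the variable `var` (if `sign = true`) or its negation (if `sign = false`). -/
structure Lit (V : Type*) where
  var : V
  sign : Bool
  deriving DecidableEq

namespace Lit

variable {V : Type*}

/-- The positive literal of a variable. -/
def pos (x : V) : Lit V := ⟨x, true⟩

/-- The negative literal of a variable. -/
def neg (x : V) : Lit V := ⟨x, false⟩

/-- The complementary literal. -/
def compl (l : Lit V) : Lit V := ⟨l.var, !l.sign⟩

end Lit

/-- A QBF in prenex conjunctive normal form `Q₁X₁ … QₙXₙ. ψ`: the list of the quantifier blocks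
`(Qᵢ, Xᵢ)`, outermost block first, and the matrix `ψ`, a finite set of clauses, each of which is a
finite set of literals. -/
structure PCNF (V : Type*) where
  blocks : List (Quantifier × Finset V)
  matrix : Finset (Finset (Lit V))

namespace PCNF

variable {V : Type*} [DecidableEq V]

/-- The variables of the quantifier blocks, `X₁ ∪ … ∪ Xₙ`. -/
def vars (φ : PCNF V) : Finset V := φ.blocks.toFinset.biUnion Prod.snd

/-- The variable `x` is quantified by `q`. -/
def HasQuant (φ : PCNF V) (x : V) (q : Quantifier) : Prop :=
  ∃ b ∈ φ.blocks, b.1 = q ∧ x ∈ b.2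

/-- `x` is in the `i`-th quantifier block. -/
def InBlock (φ : PCNF V) (x : V) (i : ℕ) : Prop :=
  ∃ b, φ.blocks[i]? = some b ∧ x ∈ b.2

/-- `x <_Π y`: the block of `x` is strictly to the left of the block of `y`. -/
def Before (φ : PCNF V) (x y : V) : Prop :=
  ∃ i j, φ.InBlock x i ∧ φ.InBlock y j ∧ i < j

/-- `x ≤_Π y`: the block of `x` is not to the right of the block of `y`. -/
def BeforeEq (φ : PCNF V) (x y : V) : Prop :=
  ∃ i j, φ.InBlock x i ∧ φ.InBlock y j ∧ i ≤ j

/-- `A` is a (possibly partial) assignment of the variables of `φ`, given as the set of the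
literals made true: it mentions only variables of `φ`, and every variable at most once. -/
def IsAssignment (φ : PCNF V) (A : Finset (Lit V)) : Prop :=
  (∀ l ∈ A, l.var ∈ φ.vars) ∧ ∀ l ∈ A, ∀ l' ∈ A, l.var = l'.var → l = l'

/-- `φ[A]`: clauses containing a literal of `A` are removed, the complements of literals of `A` are
deleted from the remaining clauses, and the variables of `A` are removed from the blocks. -/
def assign (φ : PCNF V) (A : Finset (Lit V)) : PCNF V where
  blocks := φ.blocks.map fun b => (b.1, b.2 \ A.image Lit.var)
  matrix := (φ.matrix.filter fun C => Disjoint A C).image fun C => C.filter fun l => l.compl ∉ A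

/-- Satisfiability of QBFs: a QBF with empty matrix is satisfiable, and otherwise one branches on a
variable of the outermost nonempty block. A QBF with the empty clause in its matrix is never
satisfiable, because that clause survives all assignments. -/
inductive Satisfiable : PCNF V → Prop
  | emptyMatrix (φ : PCNF V) : φ.matrix = ∅ → Satisfiable φ
  | dropBlock (q : Quantifier) (bs : List (Quantifier × Finset V)) (ψ : Finset (Finset (Lit V))) :
      Satisfiable ⟨bs, ψ⟩ → Satisfiable ⟨(q, ∅) :: bs, ψ⟩
  | exBranch (X : Finset V) (bs : List (Quantifier × Finset V)) (ψ : Finset (Finset (Lit V)))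
      (l : Lit V) : l.var ∈ X →
      Satisfiable (assign ⟨(Quantifier.ex, X) :: bs, ψ⟩ {l}) →
      Satisfiable ⟨(Quantifier.ex, X) :: bs, ψ⟩
  | allBranch (X : Finset V) (bs : List (Quantifier × Finset V)) (ψ : Finset (Finset (Lit V)))
      (x : V) : x ∈ X →
      Satisfiable (assign ⟨(Quantifier.all, X) :: bs, ψ⟩ {Lit.pos x}) →
      Satisfiable (assign ⟨(Quantifier.all, X) :: bs, ψ⟩ {Lit.neg x}) →
      Satisfiable ⟨(Quantifier.all, X) :: bs, ψ⟩

/-- The existential abstraction: all variables become existential, in one single block. -/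
def eabs (φ : PCNF V) : PCNF V where
  blocks := [(Quantifier.ex, φ.vars)]
  matrix := φ.matrix

/-- Unit literal: `(l)` is a clause and `l` is existential. -/
def IsUnit (φ : PCNF V) (l : Lit V) : Prop :=
  {l} ∈ φ.matrix ∧ φ.HasQuant l.var Quantifier.ex

/-- The literal `l` occurs in the matrix and its complement does not. -/
def IsPure (φ : PCNF V) (l : Lit V) : Prop :=
  (∃ C ∈ φ.matrix, l ∈ C) ∧ ∀ C ∈ φ.matrix, l.compl ∉ C

/-- `l` may be assigned by unit or pure literal detection: a unit literal, a pure existential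
literal, or the complement of a pure universal literal. -/
def Propagates (φ : PCNF V) (l : Lit V) : Prop :=
  φ.IsUnit l ∨ (φ.IsPure l ∧ φ.HasQuant l.var Quantifier.ex) ∨
    (φ.IsPure l.compl ∧ φ.HasQuant l.var Quantifier.all)

/-- `φ.QBCP A B`: starting with the assignment `A`, repeated unit and pure literal detection can
lead to the assignment `B`. -/
inductive QBCP (φ : PCNF V) (A : Finset (Lit V)) : Finset (Lit V) → Prop
  | start : QBCP φ A A
  | step (B : Finset (Lit V)) (l : Lit V) :
      QBCP φ A B → (φ.assign B).Propagates l → QBCP φ A (insert l B)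

/-- QCDCL assignments `A = A' ∪ A''`, with decisions `A'` and propagated literals `A''`: all
variables to the left of a maximal decision are assigned, and the literals of `A''` are assigned by
a complete run of unit and pure literal detection on `φ[A']`. -/
def IsQCDCLAssignment (φ : PCNF V) (A : Finset (Lit V)) : Prop :=
  φ.IsAssignment A ∧ ∃ A' A'' : Finset (Lit V), A = A' ∪ A'' ∧
    (∀ l ∈ A', (∀ l' ∈ A', φ.BeforeEq l'.var l.var) →
      ∀ x ∈ φ.vars, φ.Before x l.var → x ∈ A.image Lit.var) ∧
    ∃ B, φ.QBCP A' B ∧ (∀ l, ¬ (φ.assign B).Propagates l) ∧ A'' ⊆ B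

end PCNF

/-- A line of a derivation: a clause or a cube, each given by its set of literals. -/
inductive Line (V : Type*) where
  | clause (C : Finset (Lit V))
  | cube (C : Finset (Lit V))

namespace Line

variable {V : Type*}

/-- The set of literals of a line. -/
def lits : Line V → Finset (Lit V)
  | clause C => C
  | cube C => C

end Line

section Calculus

variable {V : Type*} [DecidableEq V]

/-- The set of literals `C` contains no complementary literals. -/
def NonTaut (C : Finset (Lit V)) : Prop := ∀ x : V, ¬ (Lit.pos x ∈ C ∧ Lit.neg x ∈ C)

/-- The rules of the (traditional) Q-resolution calculus QRES for `φ`: `QRES φ P L` says that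
the line `L` follows by one application of a rule from premises in the set `P`. -/
inductive QRES (φ : PCNF V) (P : Set (Line V)) : Line V → Prop
  | resClause (C₁ C₂ : Finset (Lit V)) (p : Lit V) :
      NonTaut (C₁ ∪ C₂) → p.compl ∉ C₁ → p ∉ C₂ → φ.HasQuant p.var Quantifier.ex →
      Line.clause (C₁ ∪ {p}) ∈ P → Line.clause (C₂ ∪ {p.compl}) ∈ P →
      QRES φ P (Line.clause (C₁ ∪ C₂))
  | resCube (C₁ C₂ : Finset (Lit V)) (p : Lit V) :
      NonTaut (C₁ ∪ C₂) → p.compl ∉ C₁ → p ∉ C₂ → φ.HasQuant p.var Quantifier.all →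
      Line.cube (C₁ ∪ {p}) ∈ P → Line.cube (C₂ ∪ {p.compl}) ∈ P →
      QRES φ P (Line.cube (C₁ ∪ C₂))
  | redClause (C : Finset (Lit V)) (l : Lit V) :
      NonTaut (C ∪ {l}) → φ.HasQuant l.var Quantifier.all →
      (∀ l' ∈ C, φ.HasQuant l'.var Quantifier.ex → φ.Before l'.var l.var) →
      Line.clause (C ∪ {l}) ∈ P → QRES φ P (Line.clause C)
  | redCube (C : Finset (Lit V)) (l : Lit V) :
      NonTaut (C ∪ {l}) → φ.HasQuant l.var Quantifier.ex →
      (∀ l' ∈ C, φ.HasQuant l'.var Quantifier.all → φ.Before l'.var l.var) →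
      Line.cube (C ∪ {l}) ∈ P → QRES φ P (Line.cube C)
  | clInit (C : Finset (Lit V)) :
      NonTaut C → C ∈ φ.matrix → QRES φ P (Line.clause C)
  | cuInit (A : Finset (Lit V)) :
      φ.IsQCDCLAssignment A → (φ.assign A).matrix = ∅ → QRES φ P (Line.cube A)

/-- The abstraction-based clause axiom, applied with the assignment `A`: if the existential
abstraction of `φ` is unsatisfiable under `A`, then the clause of the complements of the literals
of `A` may be derived. -/
def AbsClInit (φ : PCNF V) (A : Finset (Lit V)) (L : Line V) : Prop :=
  φ.IsAssignment A ∧ ¬ (φ.eabs.assign A).Satisfiable ∧ L = Line.clause (A.image Lit.compl)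

/-- The rules of QRES together with the abstraction-based clause axiom. -/
def QRESAbs (φ : PCNF V) (P : Set (Line V)) (L : Line V) : Prop :=
  QRES φ P L ∨ ∃ A, AbsClInit φ A L

/-- The matrix contains complementary unit clauses `(l)` and `(l.compl)`. -/
def HasComplementaryUnits (φ : PCNF V) : Prop :=
  ∃ l : Lit V, {l} ∈ φ.matrix ∧ {l.compl} ∈ φ.matrix

end Calculus

section Derivations

variable {V : Type*}

/-- `π` is a derivation with respect to the rules `R`: every line follows by `R` from earlier
lines. -/
def IsDerivation (R : Set (Line V) → Line V → Prop) (π : List (Line V)) : Prop :=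
  ∀ i (h : i < π.length), R {L | L ∈ π.take i} π[i]

/-- A clause resolution proof (refutation): a derivation that contains the empty clause. -/
def IsRefutation (R : Set (Line V) → Line V → Prop) (π : List (Line V)) : Prop :=
  IsDerivation R π ∧ Line.clause ∅ ∈ π

/-- The total size of a derivation: the number of its lines plus the number of all occurrences of
literals in them. -/
def totalSize (π : List (Line V)) : ℕ := (π.map fun L => 1 + L.lits.card).sum

end Derivations

/-- The variables `dᵢ`, `eᵢ`, `xᵢ`, `fᵢ` of the formulas of Kleine Büning et al. -/
inductive KBVar where
  | d (i : ℕ)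
  | e (i : ℕ)
  | x (i : ℕ)
  | f (i : ℕ)
  deriving DecidableEq

section KleineBuening

open KBVar Lit

/-- The quantifier blocks
`∃ d₀ d₁ e₁ ∀ x₁ ∃ d₂ e₂ ∀ x₂ … ∃ dₜ eₜ ∀ xₜ ∃ f₁ … fₜ` (for `t ≥ 1`). -/
def kbBlocks (t : ℕ) : List (Quantifier × Finset KBVar) :=
  [(Quantifier.ex, {d 0, d 1, e 1})] ++
  (List.range (t - 1)).flatMap (fun i =>
    [(Quantifier.all, {x (i + 1)}), (Quantifier.ex, {d (i + 2), e (i + 2)})]) ++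
  [(Quantifier.all, {x t}), (Quantifier.ex, (Finset.Icc 1 t).image f)]

/-- The literals `¬f₁, …, ¬fₜ`. -/
def kbNegF (t : ℕ) : Finset (Lit KBVar) := (Finset.Icc 1 t).image fun i => neg (f i)

/-- The matrix: the clauses `C₀`, `C₁`, then `C₂ⱼ`, `C₂ⱼ₊₁` for `1 ≤ j < t`, then `C₂ₜ`, `C₂ₜ₊₁`,
then `B₂ⱼ₋₁`, `B₂ⱼ` for `1 ≤ j ≤ t`. -/
def kbMatrix (t : ℕ) : Finset (Finset (Lit KBVar)) :=
  {{neg (d 0)}, {pos (d 0), neg (d 1), neg (e 1)}} ∪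
  (Finset.Ico 1 t).image (fun j => {pos (d j), neg (x j), neg (d (j + 1)), neg (e (j + 1))}) ∪
  (Finset.Ico 1 t).image (fun j => {pos (e j), pos (x j), neg (d (j + 1)), neg (e (j + 1))}) ∪
  {{pos (d t), neg (x t)} ∪ kbNegF t, {pos (e t), pos (x t)} ∪ kbNegF t} ∪
  (Finset.Icc 1 t).image (fun j => {pos (x j), pos (f j)}) ∪
  (Finset.Icc 1 t).image (fun j => {neg (x j), pos (f j)})

/-- The formula `φₜ` of Kleine Büning, Karpinski and Flögel (for `t ≥ 1`). -/
def kb (t : ℕ) : PCNF KBVar := ⟨kbBlocks t, kbMatrix t⟩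

end KleineBuening

end QBF

/-! Only the two bounds for `kb t` need work, since every rule of QRES is also a rule of QRES-abs.

Upper bound: under the assignment `¬f j` the clauses `x j ∨ f j` and `¬x j ∨ f j` become
complementary units, so the abstraction axiom yields the unit clause `f j`, which amounts to
resolving on a universal variable. The units `f j` strip the last two long clauses of their
`f`-literals, reduction of `x t` leaves the units `d t` and `e t`, and these propagate level by
level down to `d 0`.

Lower bound: fix a sequence `a` of universal answers and let the existential player follow `kbPlay
a`, where `x j = a j` is the only good reply. A line is critical at level `i` if its existential
literals precede `x i` and all its `KBAncestor`s are falsified on the variables before `x i`. The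
empty clause is critical at level 1. In the earliest critical line no `x j` with `j ≤ i` has been
reduced among the ancestors, so such literals persist from the axioms
(`IsCritical.mem_of_mem_ancestor`). Choosing continuations of the play shows which axioms occur
among the ancestors (`IsCritical.exists_axiom`). Hence that line contains the literal of `x i` false
under `a` and is critical at level `i + 1`. At level `t` the earliest critical line contains, for
every `j`, the literal of `x j` false under `a`. Clauses are not tautological, so different `a` need
different lines, giving `2 ^ t` of them. Cubes never yield clauses and play no role. -/

namespace QBF

/-! ### Monotonicity of rules and derivations -/

section Monotone

variable {V : Type*}

theorem IsDerivation.mono_rules {R R' : Set (Line V) → Line V → Prop} {π : List (Line V)}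
    (h : ∀ P L, R P L → R' P L) (hπ : IsDerivation R π) : IsDerivation R' π :=
  fun i hi => h _ _ (hπ i hi)

theorem IsDerivation.concat {R : Set (Line V) → Line V → Prop} {π : List (Line V)}
    (hπ : IsDerivation R π) {L : Line V} (hL : R {L | L ∈ π} L) : IsDerivation R (π ++ [L]) := by
  intro i hi
  rcases Nat.lt_or_ge i π.length with h | h
  · rw [List.getElem_append_left h, List.take_append_of_le_length h.le]
    exact hπ i h
  · obtain rfl : i = π.length := by
      simp only [List.length_append, List.length_singleton] at hi
      omega
    simpa using hL

variable [DecidableEq V]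

theorem QRES.mono {φ : PCNF V} {P Q : Set (Line V)} (h : P ⊆ Q) {L : Line V}
    (hL : QRES φ P L) : QRES φ Q L := by
  cases hL with
  | resClause C₁ C₂ p h₁ h₂ h₃ h₄ h₅ h₆ => exact .resClause C₁ C₂ p h₁ h₂ h₃ h₄ (h h₅) (h h₆)
  | resCube C₁ C₂ p h₁ h₂ h₃ h₄ h₅ h₆ => exact .resCube C₁ C₂ p h₁ h₂ h₃ h₄ (h h₅) (h h₆)
  | redClause C l h₁ h₂ h₃ h₄ => exact .redClause C l h₁ h₂ h₃ (h h₄)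
  | redCube C l h₁ h₂ h₃ h₄ => exact .redCube C l h₁ h₂ h₃ (h h₄)
  | clInit C h₁ h₂ => exact .clInit C h₁ h₂
  | cuInit A h₁ h₂ => exact .cuInit A h₁ h₂

end Monotone

/-! ### A syntactic criterion for unsatisfiability -/

section Unsatisfiable

variable {V : Type*}

theorem Lit.compl_compl (l : Lit V) : l.compl.compl = l := by simp [Lit.compl]

theorem Lit.compl_ne (l : Lit V) : l.compl ≠ l := by
  intro h
  have := congrArg Lit.sign h
  simp [Lit.compl] at this

theorem Lit.eq_or_eq_compl {k l : Lit V} (h : k.var = l.var) : k = l ∨ k = l.compl := by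
  rcases k with ⟨x, b⟩
  rcases l with ⟨y, c⟩
  cases b <;> cases c <;> simp_all [Lit.compl]

variable [DecidableEq V]

/-- The matrix contains the empty clause or two complementary unit clauses. -/
def IsTriviallyFalse (φ : PCNF V) : Prop := ∅ ∈ φ.matrix ∨ HasComplementaryUnits φ

theorem PCNF.mem_matrix_assign {φ : PCNF V} {A C : Finset (Lit V)} (hC : C ∈ φ.matrix)
    (h : Disjoint A C) : C.filter (fun l => l.compl ∉ A) ∈ (φ.assign A).matrix :=
  Finset.mem_image_of_mem _ (Finset.mem_filter.2 ⟨hC, h⟩)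

/-- Assigning the variable of the two units turns one of them into the empty clause; any other
assignment leaves both intact. This is the invariant that excludes satisfiability by induction over
branches. -/
theorem IsTriviallyFalse.assign_singleton {φ : PCNF V} (h : IsTriviallyFalse φ) (k : Lit V) :
    IsTriviallyFalse (φ.assign {k}) := by
  rcases h with h | ⟨l, h₁, h₂⟩
  · left
    simpa using PCNF.mem_matrix_assign (A := {k}) h (by simp)
  · by_cases hv : k.var = l.var
    · left
      rcases Lit.eq_or_eq_compl hv with rfl | rfl
      · have := PCNF.mem_matrix_assign (A := {k}) h₂ (by simpa using (Lit.compl_ne k).symm)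
        simpa [Finset.filter_singleton, Lit.compl_compl] using this
      · have := PCNF.mem_matrix_assign (A := {l.compl}) h₁ (by simpa using Lit.compl_ne l)
        simpa [Finset.filter_singleton] using this
    · right
      have n₁ : l ≠ k := fun h => hv (by rw [h])
      have n₂ : l.compl ≠ k := fun h => hv (by rw [← h]; rfl)
      refine ⟨l, ?_, ?_⟩
      · have := PCNF.mem_matrix_assign (A := {k}) h₁ (by simpa using n₁.symm)
        simpa [Finset.filter_singleton, n₂] using this
      · have := PCNF.mem_matrix_assign (A := {k}) h₂ (by simpa using n₂.symm)
        simpa [Finset.filter_singleton, n₁, Lit.compl_compl] using this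

theorem IsTriviallyFalse.not_satisfiable {φ : PCNF V} (h : IsTriviallyFalse φ) :
    ¬ φ.Satisfiable := by
  intro hs
  induction hs with
  | emptyMatrix φ h0 =>
    rcases h with h | ⟨l, h, -⟩ <;> simp [h0] at h
  | dropBlock q bs ψ _ ih => exact ih h
  | exBranch X bs ψ l _ _ ih => exact ih (h.assign_singleton l)
  | allBranch X bs ψ x _ _ _ ih _ => exact ih (h.assign_singleton _)

end Unsatisfiable

/-! ### The quantifier prefix of the formulas -/

section BlockStructure

open KBVar Lit

/-- The `k`-th quantifier block of `kb t`, for `k ≤ 2 * t`. -/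
def kbBlock (t k : ℕ) : Quantifier × Finset KBVar :=
  if k = 0 then (Quantifier.ex, {d 0, d 1, e 1})
  else if k = 2 * t then (Quantifier.ex, (Finset.Icc 1 t).image f)
  else if k % 2 = 1 then (Quantifier.all, {x (k / 2 + 1)})
  else (Quantifier.ex, {d (k / 2 + 1), e (k / 2 + 1)})

theorem flatMap_range_pair {α : Type*} (g h : ℕ → α) (n : ℕ) :
    (List.range n).flatMap (fun i => [g i, h i]) =
      (List.range (2 * n)).map fun k => if k % 2 = 0 then g (k / 2) else h (k / 2) := by
  induction n with
  | zero => rfl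
  | succ n ih =>
    rw [List.range_succ, List.flatMap_append, ih, show 2 * (n + 1) = 2 * n + 1 + 1 by ring,
      List.range_succ, List.range_succ]
    have h₁ : (2 * n + 1) % 2 = 1 := by omega
    have h₂ : (2 * n + 1) / 2 = n := by omega
    simp [h₁, h₂]

theorem kbBlocks_eq {t : ℕ} (ht : 1 ≤ t) :
    kbBlocks t = (List.range (2 * t + 1)).map (kbBlock t) := by
  rw [kbBlocks, flatMap_range_pair]
  apply List.ext_getElem
  · simp
    omega
  · intro k h₁ h₂
    simp only [List.length_map, List.length_range] at h₂
    simp only [List.getElem_map, List.getElem_range, kbBlock]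
    rcases Nat.eq_zero_or_pos k with rfl | hk
    · simp
    rw [if_neg hk.ne']
    rcases Nat.lt_or_ge k (2 * t - 1) with h | h
    · rw [List.getElem_append_left (by simp; omega), List.getElem_append_right (by simp; omega)]
      simp only [List.length_singleton, List.getElem_map, List.getElem_range]
      rw [if_neg (show k ≠ 2 * t by omega)]
      by_cases hp : k % 2 = 1
      · rw [if_pos (by omega), if_pos hp, show (k - 1) / 2 + 1 = k / 2 + 1 by omega]
      · rw [if_neg (by omega), if_neg hp, show (k - 1) / 2 + 2 = k / 2 + 1 by omega]
    · rw [List.getElem_append_right (by simp; omega)]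
      simp only [List.length_append, List.length_singleton, List.length_map, List.length_range]
      rcases Nat.eq_or_lt_of_le h with rfl | h
      · simp only [show 2 * t - 1 - (1 + 2 * (t - 1)) = 0 by omega, List.getElem_cons_zero]
        rw [if_neg (by omega), if_pos (by omega), show (2 * t - 1) / 2 + 1 = t by omega]
      · obtain rfl : k = 2 * t := by omega
        simp [show 2 * t - (1 + 2 * (t - 1)) = 1 by omega]

/-- The number of the quantifier block of `kb t` that contains the variable. -/
def kbBlockIndex (t : ℕ) : KBVar → ℕ
  -- Truncated subtraction places `d 0` in block 0, together with `d 1` and `e 1`.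
  | d j => 2 * j - 2
  | e j => 2 * j - 2
  | x j => 2 * j - 1
  | f _ => 2 * t

/-- The variables of `kb t`. -/
def IsKBVar (t : ℕ) : KBVar → Prop
  | d j => j ≤ t
  | e j => 1 ≤ j ∧ j ≤ t
  | x j => 1 ≤ j ∧ j ≤ t
  | f j => 1 ≤ j ∧ j ≤ t

/-- The quantifier of a variable of `kb t`. -/
def kbQuant : KBVar → Quantifier
  | x _ => .all
  | _ => .ex

theorem mem_kbBlock_iff {t k : ℕ} (ht : 1 ≤ t) (hk : k ≤ 2 * t) (v : KBVar) :
    v ∈ (kbBlock t k).2 ↔ IsKBVar t v ∧ kbBlockIndex t v = k := by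
  unfold kbBlock
  split_ifs with h₁ h₂ h₃ <;> cases v <;>
    simp only [kbBlockIndex, IsKBVar, Finset.mem_insert, Finset.mem_singleton, Finset.mem_image,
      Finset.mem_Icc, reduceCtorEq, d.injEq, e.injEq, x.injEq, f.injEq, exists_eq_right,
      or_false, false_or, and_false, exists_false, false_iff, not_and] <;> omega

theorem kbBlock_fst {t k : ℕ} {v : KBVar} (h : v ∈ (kbBlock t k).2) :
    (kbBlock t k).1 = kbQuant v := by
  unfold kbBlock at h ⊢
  split_ifs at h ⊢ <;> cases v <;> simp_all [kbQuant]

theorem kb_inBlock_iff {t : ℕ} (ht : 1 ≤ t) (v : KBVar) (k : ℕ) :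
    (kb t).InBlock v k ↔ IsKBVar t v ∧ kbBlockIndex t v = k := by
  constructor
  · rintro ⟨b, hb, hv⟩
    simp only [kb, kbBlocks_eq ht] at hb
    obtain ⟨hk, rfl⟩ := List.getElem?_eq_some_iff.1 hb
    simp only [List.length_map, List.length_range] at hk
    simp only [List.getElem_map, List.getElem_range] at hv
    exact (mem_kbBlock_iff ht (by omega) v).1 hv
  · intro h
    have hk : k ≤ 2 * t := by
      rcases h with ⟨h, rfl⟩
      cases v <;> simp only [IsKBVar, kbBlockIndex] at h ⊢ <;> omega
    refine ⟨kbBlock t k, ?_, (mem_kbBlock_iff ht hk v).2 h⟩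
    simp only [kb, kbBlocks_eq ht]
    rw [List.getElem?_eq_some_iff]
    exact ⟨by simp; omega, by simp⟩

theorem kb_hasQuant_iff {t : ℕ} (ht : 1 ≤ t) (v : KBVar) (q : Quantifier) :
    (kb t).HasQuant v q ↔ IsKBVar t v ∧ kbQuant v = q := by
  constructor
  · rintro ⟨b, hb, rfl, hv⟩
    simp only [kb, kbBlocks_eq ht, List.mem_map, List.mem_range] at hb
    obtain ⟨k, hk, rfl⟩ := hb
    exact ⟨((mem_kbBlock_iff ht (by omega) v).1 hv).1, (kbBlock_fst hv).symm⟩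
  · rintro ⟨hv, rfl⟩
    obtain ⟨b, hb, hvb⟩ := (kb_inBlock_iff ht v _).2 ⟨hv, rfl⟩
    refine ⟨b, List.mem_of_getElem? hb, ?_, hvb⟩
    simp only [kb, kbBlocks_eq ht] at hb
    obtain ⟨hk, rfl⟩ := List.getElem?_eq_some_iff.1 hb
    simp only [List.getElem_map, List.getElem_range] at hvb ⊢
    exact kbBlock_fst hvb

theorem kb_before_iff {t : ℕ} (ht : 1 ≤ t) (v w : KBVar) :
    (kb t).Before v w ↔ IsKBVar t v ∧ IsKBVar t w ∧ kbBlockIndex t v < kbBlockIndex t w := by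
  simp only [PCNF.Before, kb_inBlock_iff ht]
  constructor
  · rintro ⟨i, j, ⟨hv, rfl⟩, ⟨hw, rfl⟩, h⟩
    exact ⟨hv, hw, h⟩
  · rintro ⟨hv, hw, h⟩
    exact ⟨_, _, ⟨hv, rfl⟩, ⟨hw, rfl⟩, h⟩

theorem kb_mem_vars {t : ℕ} (ht : 1 ≤ t) {v : KBVar} (hv : IsKBVar t v) : v ∈ (kb t).vars := by
  obtain ⟨b, hb, -, hvb⟩ := (kb_hasQuant_iff ht v (kbQuant v)).2 ⟨hv, rfl⟩
  exact Finset.mem_biUnion.2 ⟨b, by simpa using hb, hvb⟩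

end BlockStructure

/-! ### Derivations with a size budget -/

section DerivableWithin

variable {V : Type*}

/-- There is a derivation by the rules `R` of total size at most `n` that contains all lines of
`S`. -/
def DerivableWithin (R : Set (Line V) → Line V → Prop) (n : ℕ) (S : Set (Line V)) : Prop :=
  ∃ π, IsDerivation R π ∧ (∀ L ∈ S, L ∈ π) ∧ totalSize π ≤ n

variable {R : Set (Line V) → Line V → Prop} {n : ℕ} {S : Set (Line V)}

theorem DerivableWithin.empty (R : Set (Line V) → Line V → Prop) : DerivableWithin R 0 ∅ :=
  ⟨[], fun i hi => absurd hi (by simp), by simp, by simp [totalSize]⟩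

theorem DerivableWithin.mono {n' : ℕ} {S' : Set (Line V)} (h : DerivableWithin R n S)
    (hn : n ≤ n') (hS : S' ⊆ S) : DerivableWithin R n' S' := by
  obtain ⟨π, h₁, h₂, h₃⟩ := h
  exact ⟨π, h₁, fun L hL => h₂ L (hS hL), h₃.trans hn⟩

theorem DerivableWithin.insert (hR : ∀ ⦃P Q L⦄, P ⊆ Q → R P L → R Q L)
    (h : DerivableWithin R n S) {L : Line V} (hL : R S L) {k : ℕ} (hk : L.lits.card < k) :
    DerivableWithin R (n + k) (insert L S) := by
  obtain ⟨π, h₁, h₂, h₃⟩ := h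
  refine ⟨π ++ [L], h₁.concat (hR h₂ hL), ?_, ?_⟩
  · rintro K (rfl | hK)
    · simp
    · exact List.mem_append_left _ (h₂ K hK)
  · simp only [totalSize, List.map_append, List.map_cons, List.map_nil, List.sum_append,
      List.sum_singleton] at h₃ ⊢
    omega

end DerivableWithin

/-! ### The short refutation with the abstraction axiom -/

section UpperBound

open KBVar Lit

/-- The rules of QRES for `kb t` together with the abstraction-based clause axiom, restricted to
assignments that lead to complementary unit clauses. -/
def KBAbsRule (t : ℕ) (P : Set (Line KBVar)) (L : Line KBVar) : Prop :=
  QRES (kb t) P L ∨ ∃ A, AbsClInit (kb t) A L ∧ HasComplementaryUnits ((kb t).eabs.assign A)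

theorem KBAbsRule.mono {t : ℕ} ⦃P Q : Set (Line KBVar)⦄ ⦃L : Line KBVar⦄ (h : P ⊆ Q)
    (hL : KBAbsRule t P L) : KBAbsRule t Q L :=
  hL.imp_left (QRES.mono h)

theorem NonTaut.subset {V : Type*} {C D : Finset (Lit V)} (h : NonTaut D) (hC : C ⊆ D) :
    NonTaut C :=
  fun x hx => h x ⟨hC hx.1, hC hx.2⟩

theorem mem_kbMatrix_iff {t : ℕ} {C : Finset (Lit KBVar)} : C ∈ kbMatrix t ↔
    C = {neg (d 0)} ∨ C = {pos (d 0), neg (d 1), neg (e 1)} ∨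
    (∃ j, 1 ≤ j ∧ j < t ∧ C = {pos (d j), neg (x j), neg (d (j + 1)), neg (e (j + 1))}) ∨
    (∃ j, 1 ≤ j ∧ j < t ∧ C = {pos (e j), pos (x j), neg (d (j + 1)), neg (e (j + 1))}) ∨
    C = {pos (d t), neg (x t)} ∪ kbNegF t ∨ C = {pos (e t), pos (x t)} ∪ kbNegF t ∨
    (∃ j, 1 ≤ j ∧ j ≤ t ∧ C = {pos (x j), pos (f j)}) ∨
    (∃ j, 1 ≤ j ∧ j ≤ t ∧ C = {neg (x j), pos (f j)}) := by
  simp only [kbMatrix, Finset.mem_union, Finset.mem_insert, Finset.mem_singleton,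
    Finset.mem_image, Finset.mem_Ico, Finset.mem_Icc, and_assoc, or_assoc, @eq_comm _ _ C]

/-- The only use of the abstraction axiom; the complementary units are `x j` and `¬x j`. -/
theorem kbAbsRule_unit {t j : ℕ} (ht : 1 ≤ t) (h₁ : 1 ≤ j) (h₂ : j ≤ t) (P : Set (Line KBVar)) :
    KBAbsRule t P (.clause {pos (f j)}) := by
  have hu : HasComplementaryUnits ((kb t).eabs.assign {neg (f j)}) := by
    refine ⟨pos (x j), ?_, ?_⟩
    · have := PCNF.mem_matrix_assign (φ := (kb t).eabs) (A := {neg (f j)})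
        (C := {pos (x j), pos (f j)}) (mem_kbMatrix_iff.2
          (.inr (.inr (.inr (.inr (.inr (.inr (.inl ⟨j, h₁, h₂, rfl⟩))))))))
        (by simp [pos, neg])
      simpa [Finset.filter_insert, Finset.filter_singleton, Lit.compl, pos, neg] using this
    · have := PCNF.mem_matrix_assign (φ := (kb t).eabs) (A := {neg (f j)})
        (C := {neg (x j), pos (f j)}) (mem_kbMatrix_iff.2
          (.inr (.inr (.inr (.inr (.inr (.inr (.inr ⟨j, h₁, h₂, rfl⟩))))))))
        (by simp [pos, neg])
      simpa [Finset.filter_insert, Finset.filter_singleton, Lit.compl, pos, neg] using this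
  refine Or.inr ⟨{neg (f j)}, ⟨⟨?_, ?_⟩, IsTriviallyFalse.not_satisfiable (.inr hu), ?_⟩, hu⟩
  · intro l hl
    rw [Finset.mem_singleton.1 hl]
    exact kb_mem_vars ht (v := f j) ⟨h₁, h₂⟩
  · simp
  · simp [Lit.compl, pos, neg]

theorem kbAbsRule_unitRes {t : ℕ} (ht : 1 ≤ t) {P : Set (Line KBVar)} {v : KBVar}
    (hv : IsKBVar t v) (hq : kbQuant v = .ex) {C : Finset (Lit KBVar)} (hC : NonTaut C)
    (hvC : pos v ∉ C) (h₁ : Line.clause {pos v} ∈ P) (h₂ : Line.clause (insert (neg v) C) ∈ P) :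
    KBAbsRule t P (.clause C) := by
  have := QRES.resClause (φ := kb t) (P := P) ∅ C (pos v) (by simpa using hC) (by simp) hvC
    ((kb_hasQuant_iff ht v _).2 ⟨hv, hq⟩) (by simpa using h₁)
    (by rwa [Finset.union_comm, ← Finset.insert_eq])
  exact .inl (by simpa using this)

/-- The block of `d j` and `e j` lies just left of `x j`, so once the later existentials are gone
the reduction of `x j` is allowed. -/
theorem kbAbsRule_reduce {t j : ℕ} (ht : 1 ≤ t) (h₁ : 1 ≤ j) (h₂ : j ≤ t) {P : Set (Line KBVar)}
    {v : KBVar} (hv : v = d j ∨ v = e j) {l : Lit KBVar} (hl : l.var = x j)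
    (h : Line.clause {pos v, l} ∈ P) : KBAbsRule t P (.clause {pos v}) := by
  have hx : IsKBVar t (x j) := ⟨h₁, h₂⟩
  have hv' : IsKBVar t v := by
    rcases hv with rfl | rfl
    exacts [h₂, hx]
  refine .inl (.redClause {pos v} l ?_ ?_ ?_ h)
  · rcases l with ⟨_, b⟩
    obtain rfl : _ = x j := hl
    rcases hv with rfl | rfl <;> cases b <;> simp [NonTaut, pos, neg]
  · rw [hl, kb_hasQuant_iff ht]
    exact ⟨hx, rfl⟩
  · intro l' hl' _
    rw [Finset.mem_singleton] at hl'
    subst hl'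
    rw [hl, kb_before_iff ht]
    refine ⟨hv', hx, ?_⟩
    rcases hv with rfl | rfl <;> simp only [kbBlockIndex, pos] <;> omega

theorem kbAbsRule_clInit {t : ℕ} {P : Set (Line KBVar)} {C : Finset (Lit KBVar)} (h : NonTaut C)
    (hC : C ∈ kbMatrix t) : KBAbsRule t P (.clause C) :=
  .inl (.clInit C h hC)

/-- The unit clauses `f₁, …, fₖ`. -/
def kbFUnits (k : ℕ) : Set (Line KBVar) := {L | ∃ j, 1 ≤ j ∧ j ≤ k ∧ L = .clause {pos (f j)}}

theorem derivableWithin_kbFUnits {t : ℕ} (ht : 1 ≤ t) {k : ℕ} (hk : k ≤ t) :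
    DerivableWithin (KBAbsRule t) (2 * k) (kbFUnits k) := by
  induction k with
  | zero =>
    refine (DerivableWithin.empty _).mono le_rfl ?_
    rintro L ⟨j, h₁, h₂, -⟩
    omega
  | succ k ih =>
    refine ((ih (by omega)).insert KBAbsRule.mono
      (kbAbsRule_unit ht (Nat.succ_pos k) hk _) (k := 2) (by simp [Line.lits])).mono le_rfl ?_
    rintro L ⟨j, h₁, h₂, rfl⟩
    rcases Nat.lt_or_ge k j with h | h
    · obtain rfl : j = k + 1 := by omega
      exact Set.mem_insert _ _
    · exact Set.mem_insert_of_mem _ ⟨j, h₁, h, rfl⟩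

/-- One axiom line and `k` resolutions with units; each line has at most `t + 2` literals and hence
size at most `t + 3`. -/
theorem derivableWithin_eliminate_kbNegF {t n : ℕ} (ht : 1 ≤ t) {S : Set (Line KBVar)}
    (hS : kbFUnits t ⊆ S) (h : DerivableWithin (KBAbsRule t) n S) {C : Finset (Lit KBVar)}
    (hC : NonTaut C) (hf : ∀ j b, (⟨f j, b⟩ : Lit KBVar) ∉ C) (hc : C.card ≤ 2)
    (hm : C ∪ kbNegF t ∈ kbMatrix t) {k : ℕ} (hk : k ≤ t) :
    DerivableWithin (KBAbsRule t) (n + (k + 1) * (t + 3))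
      (insert (.clause (C ∪ (Finset.Icc (k + 1) t).image fun i => neg (f i))) S) := by
  have hnt : ∀ k, NonTaut (C ∪ (Finset.Icc (k + 1) t).image fun i => neg (f i)) := by
    rintro k v ⟨h₁, h₂⟩
    simp only [Finset.mem_union, Finset.mem_image] at h₁ h₂
    rcases h₁ with h₁ | ⟨i, -, h₁⟩
    · rcases h₂ with h₂ | ⟨i, -, h₂⟩
      · exact hC v ⟨h₁, h₂⟩
      · simp only [neg, Lit.mk.injEq, and_true] at h₂
        exact hf i true (h₂ ▸ h₁)
    · simp [pos, neg] at h₁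
  have hcard : ∀ k,
      (Line.clause (C ∪ (Finset.Icc (k + 1) t).image fun i => neg (f i))).lits.card < t + 3 := by
    intro k
    have h₁ := Finset.card_union_le C ((Finset.Icc (k + 1) t).image fun i => neg (f i))
    have h₂ := Finset.card_image_le (s := Finset.Icc (k + 1) t) (f := fun i => neg (f i))
    simp only [Nat.card_Icc] at h₂
    simp only [Line.lits]
    omega
  induction k with
  | zero =>
    refine (h.insert KBAbsRule.mono (kbAbsRule_clInit (hnt 0) hm) (hcard 0)).mono (by omega) ?_
    exact le_rfl
  | succ k ih =>
    refine ((ih (by omega)).insert KBAbsRule.mono (kbAbsRule_unitRes ht (v := f (k + 1))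
      ⟨by omega, hk⟩ rfl (hnt (k + 1)) ?_ ?_ ?_) (hcard _)).mono (by apply le_of_eq; ring) ?_
    · simp only [Finset.mem_union, Finset.mem_image, not_or, pos]
      exact ⟨hf _ _, by simp [neg]⟩
    · exact Set.mem_insert_of_mem _ (hS ⟨k + 1, by omega, hk, rfl⟩)
    · refine Or.inl ?_
      rw [← Finset.insert_Icc_add_one_left_eq_Icc hk, Finset.image_insert, Finset.union_insert]
    · exact Set.insert_subset_insert (Set.subset_insert _ _)

theorem derivableWithin_last_unit {t n : ℕ} (ht : 1 ≤ t) {S : Set (Line KBVar)}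
    (hS : kbFUnits t ⊆ S) (h : DerivableWithin (KBAbsRule t) n S) {v : KBVar}
    (hv : v = d t ∨ v = e t) {b : Bool} (hm : {pos v, ⟨x t, b⟩} ∪ kbNegF t ∈ kbMatrix t) :
    DerivableWithin (KBAbsRule t) (n + (t + 1) * (t + 3) + 2)
      (insert (.clause {pos v}) S) := by
  have h₁ := derivableWithin_eliminate_kbNegF ht hS h (C := {pos v, ⟨x t, b⟩})
    (by rcases hv with rfl | rfl <;> cases b <;> simp [NonTaut, pos, neg])
    (by rcases hv with rfl | rfl <;> simp [pos]) Finset.card_le_two hm le_rfl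
  refine (h₁.insert KBAbsRule.mono (kbAbsRule_reduce ht ht le_rfl hv (l := ⟨x t, b⟩) rfl ?_)
    (k := 2) (by simp [Line.lits])).mono le_rfl
    (Set.insert_subset_insert (Set.subset_insert _ _))
  simp

theorem derivableWithin_unit_step {t n j : ℕ} (h₁ : 1 ≤ j) (h₂ : j < t)
    {S : Set (Line KBVar)} (h : DerivableWithin (KBAbsRule t) n S) {v : KBVar}
    (hv : v = d j ∨ v = e j) {b : Bool}
    (hm : {pos v, ⟨x j, b⟩, neg (d (j + 1)), neg (e (j + 1))} ∈ kbMatrix t)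
    (hd : Line.clause {pos (d (j + 1))} ∈ S) (he : Line.clause {pos (e (j + 1))} ∈ S) :
    -- The clause shrinks from four literals to one, so the lines cost 5 + 4 + 3 + 2 = 14.
    DerivableWithin (KBAbsRule t) (n + 14) (insert (.clause {pos v}) S) := by
  have ht : 1 ≤ t := by omega
  have n₁ : NonTaut {pos v, ⟨x j, b⟩, neg (d (j + 1)), neg (e (j + 1))} := by
    rcases hv with rfl | rfl <;> cases b <;> simp [NonTaut, pos, neg]
  have a₁ := h.insert KBAbsRule.mono (kbAbsRule_clInit n₁ hm) (k := 5)
    (Nat.lt_succ_of_le Finset.card_le_four)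
  have a₂ := a₁.insert KBAbsRule.mono (kbAbsRule_unitRes ht (v := d (j + 1))
    (C := {pos v, ⟨x j, b⟩, neg (e (j + 1))}) h₂ rfl
    (n₁.subset (by grind)) (by rcases hv with rfl | rfl <;> simp [pos, neg])
    (Set.mem_insert_of_mem _ hd) (Or.inl (congrArg _ (by grind)))) (k := 4)
    (Nat.lt_succ_of_le Finset.card_le_three)
  have a₃ := a₂.insert KBAbsRule.mono (kbAbsRule_unitRes ht (v := e (j + 1))
    (C := {pos v, ⟨x j, b⟩}) ⟨by omega, h₂⟩ rfl
    (n₁.subset (by grind)) (by rcases hv with rfl | rfl <;> simp [pos])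
    (Set.mem_insert_of_mem _ (Set.mem_insert_of_mem _ he))
    (Or.inl (congrArg _ (by grind)))) (k := 3) (Nat.lt_succ_of_le Finset.card_le_two)
  refine (a₃.insert KBAbsRule.mono (kbAbsRule_reduce ht h₁ h₂.le hv (l := ⟨x j, b⟩) rfl
    (Set.mem_insert _ _)) (k := 2) (by simp [Line.lits])).mono (by omega) ?_
  grind

theorem derivableWithin_units {t : ℕ} (ht : 1 ≤ t) {k : ℕ} (hk : k < t) :
    DerivableWithin (KBAbsRule t) (2 * t + 2 * ((t + 1) * (t + 3) + 2) + 28 * k)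
      {.clause {pos (d (t - k))}, .clause {pos (e (t - k))}} := by
  induction k with
  | zero =>
    have a₁ := derivableWithin_last_unit ht subset_rfl (derivableWithin_kbFUnits ht le_rfl)
      (v := d t) (b := false) (.inl rfl) (mem_kbMatrix_iff.2 (by simp [neg]))
    have a₂ := derivableWithin_last_unit ht (Set.subset_insert _ _) a₁
      (v := e t) (b := true) (.inr rfl) (mem_kbMatrix_iff.2 (by simp [pos]))
    exact a₂.mono (by omega) (by grind)
  | succ k ih =>
    obtain ⟨j, hj⟩ : ∃ j, t - (k + 1) = j := ⟨_, rfl⟩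
    have a₀ := ih (by omega)
    rw [show t - k = j + 1 by omega] at a₀
    rw [hj]
    have h₁ : 1 ≤ j := by omega
    have h₂ : j < t := by omega
    have a₁ := derivableWithin_unit_step h₁ h₂ a₀ (v := d j) (b := false) (.inl rfl)
      (mem_kbMatrix_iff.2 (.inr (.inr (.inl ⟨j, h₁, h₂, rfl⟩)))) (by simp) (by simp)
    have a₂ := derivableWithin_unit_step h₁ h₂ a₁ (v := e j) (b := true) (.inr rfl)
      (mem_kbMatrix_iff.2 (.inr (.inr (.inr (.inl ⟨j, h₁, h₂, rfl⟩))))) (by simp) (by simp)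
    exact a₂.mono (by omega) (by grind)

theorem derivableWithin_empty_clause {t : ℕ} (ht : 1 ≤ t) :
    DerivableWithin (KBAbsRule t) (100 * t ^ 2) {.clause ∅} := by
  have a₀ := derivableWithin_units ht (k := t - 1) (by omega)
  rw [show t - (t - 1) = 1 by omega] at a₀
  have n₁ : NonTaut {pos (d 0), neg (d 1), neg (e 1)} := by simp [NonTaut, pos, neg]
  have a₁ := a₀.insert KBAbsRule.mono (kbAbsRule_clInit n₁ (mem_kbMatrix_iff.2 (.inr (.inl rfl))))
    (k := 4) (Nat.lt_succ_of_le Finset.card_le_three)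
  have a₂ := a₁.insert KBAbsRule.mono (kbAbsRule_unitRes ht (v := d 1)
    (C := {pos (d 0), neg (e 1)}) ht rfl (n₁.subset (by grind)) (by simp [pos, neg])
    (by simp) (Or.inl (congrArg _ (by grind)))) (k := 3) (Nat.lt_succ_of_le Finset.card_le_two)
  have a₃ := a₂.insert KBAbsRule.mono (kbAbsRule_unitRes ht (v := e 1)
    (C := {pos (d 0)}) ⟨le_rfl, ht⟩ rfl (n₁.subset (by grind)) (by simp [pos])
    (by simp) (Or.inl (congrArg _ (by grind)))) (k := 2) (by simp [Line.lits])
  have a₄ := a₃.insert KBAbsRule.mono (kbAbsRule_clInit (C := {neg (d 0)})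
    (by simp [NonTaut, pos, neg]) (mem_kbMatrix_iff.2 (.inl rfl))) (k := 2) (by simp [Line.lits])
  have a₅ := a₄.insert KBAbsRule.mono (kbAbsRule_unitRes ht (v := d 0) (C := ∅) (Nat.zero_le t)
    rfl (by simp [NonTaut]) (by simp) (by simp) (by simp)) (k := 1) (by simp [Line.lits])
  refine a₅.mono ?_ (by simp)
  obtain ⟨s, rfl⟩ : ∃ s, t = s + 1 := ⟨t - 1, by omega⟩
  simp only [Nat.add_sub_cancel]
  ring_nf
  nlinarith

end UpperBound

/-! ### The exponential lower bound for QRES -/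

section LowerBound

open KBVar Lit

/-- The position of a variable in the prefix of `kb t`: existential variables have even positions,
the universal variable `x j` has position `2 * j + 1`. -/
def kbPos (t : ℕ) : KBVar → ℕ
  | d j => 2 * j
  | e j => 2 * j
  | x j => 2 * j + 1
  | f _ => 2 * t + 2

theorem kbPos_lt_of_before {t : ℕ} (ht : 1 ≤ t) {v : KBVar} {j : ℕ}
    (h : (kb t).Before v (x j)) (hv : kbQuant v = .ex) : kbPos t v < 2 * j + 1 := by
  obtain ⟨-, ⟨h₁, h₂⟩, h₃⟩ := (kb_before_iff ht v (x j)).1 h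
  cases v <;> simp only [kbBlockIndex, kbPos, kbQuant, reduceCtorEq] at * <;> omega

/-- The `n`-th line of `π` is the clause `C`. -/
def ClauseAt {V : Type*} (π : List (Line V)) (n : ℕ) (C : Finset (Lit V)) : Prop :=
  π[n]? = some (.clause C)

theorem ClauseAt.unique {V : Type*} {π : List (Line V)} {n : ℕ} {C D : Finset (Lit V)}
    (hC : ClauseAt π n C) (hD : ClauseAt π n D) : C = D := by
  simpa using hC.symm.trans hD

theorem exists_clauseAt_of_mem_take {V : Type*} {π : List (Line V)} {n : ℕ} {C : Finset (Lit V)}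
    (h : Line.clause C ∈ π.take n) : ∃ m < n, ClauseAt π m C := by
  obtain ⟨m, hm, hC⟩ := List.getElem_of_mem h
  rw [List.length_take] at hm
  refine ⟨m, by omega, ?_⟩
  rw [ClauseAt, List.getElem?_eq_some_iff]
  exact ⟨by omega, by simpa using hC⟩

theorem ClauseAt.rule {V : Type*} [DecidableEq V] {φ : PCNF V} {π : List (Line V)}
    (hπ : IsDerivation (QRES φ) π) {n : ℕ} {C : Finset (Lit V)} (hC : ClauseAt π n C) :
    QRES φ {L | L ∈ π.take n} (.clause C) := by
  obtain ⟨h, hC⟩ := List.getElem?_eq_some_iff.1 hC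
  exact hC ▸ hπ n h

theorem ClauseAt.nonTaut {V : Type*} [DecidableEq V] {φ : PCNF V} {π : List (Line V)}
    (hπ : IsDerivation (QRES φ) π) {n : ℕ} {C : Finset (Lit V)} (hC : ClauseAt π n C) :
    NonTaut C := by
  cases hC.rule hπ with
  | resClause C₁ C₂ p h => exact h
  | redClause C l h => exact h.subset Finset.subset_union_left
  | clInit C h => exact h

theorem isKBVar_of_mem_kbMatrix {t : ℕ} (ht : 1 ≤ t) {C : Finset (Lit KBVar)}
    (hC : C ∈ kbMatrix t) : ∀ l ∈ C, IsKBVar t l.var := by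
  have hF : ∀ l ∈ kbNegF t, IsKBVar t l.var := by
    intro l hl
    obtain ⟨i, hi, rfl⟩ := Finset.mem_image.1 hl
    exact Finset.mem_Icc.1 hi
  intro l hl
  rcases mem_kbMatrix_iff.1 hC with rfl | rfl | ⟨j, h₁, h₂, rfl⟩ | ⟨j, h₁, h₂, rfl⟩ | rfl |
      rfl | ⟨j, h₁, h₂, rfl⟩ | ⟨j, h₁, h₂, rfl⟩ <;>
    simp only [Finset.mem_union, Finset.mem_insert, Finset.mem_singleton, or_assoc] at hl
  · subst hl
    exact Nat.zero_le t
  · rcases hl with rfl | rfl | rfl <;> simp only [IsKBVar, pos, neg] <;> omega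
  · rcases hl with rfl | rfl | rfl | rfl <;> simp only [IsKBVar, pos, neg] <;> omega
  · rcases hl with rfl | rfl | rfl | rfl <;> simp only [IsKBVar, pos, neg] <;> omega
  · rcases hl with rfl | rfl | hl
    exacts [le_rfl, ⟨ht, le_rfl⟩, hF l hl]
  · rcases hl with rfl | rfl | hl
    exacts [⟨ht, le_rfl⟩, ⟨ht, le_rfl⟩, hF l hl]
  · rcases hl with rfl | rfl <;> exact ⟨h₁, h₂⟩
  · rcases hl with rfl | rfl <;> exact ⟨h₁, h₂⟩

/-- The side condition of reduction constrains only literals whose variables are quantified, so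
literals of other variables have to be excluded. -/
theorem ClauseAt.isKBVar {t : ℕ} (ht : 1 ≤ t) {π : List (Line KBVar)}
    (hπ : IsDerivation (QRES (kb t)) π) {n : ℕ} {C : Finset (Lit KBVar)} (hC : ClauseAt π n C) :
    ∀ l ∈ C, IsKBVar t l.var := by
  induction n using Nat.strong_induction_on generalizing C with
  | _ n ih =>
    cases hC.rule hπ with
    | resClause C₁ C₂ p _ _ _ _ h₁ h₂ =>
      obtain ⟨m₁, hm₁, h₁⟩ := exists_clauseAt_of_mem_take h₁
      obtain ⟨m₂, hm₂, h₂⟩ := exists_clauseAt_of_mem_take h₂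
      intro l hl
      rcases Finset.mem_union.1 hl with hl | hl
      · exact ih m₁ hm₁ h₁ l (Finset.mem_union_left _ hl)
      · exact ih m₂ hm₂ h₂ l (Finset.mem_union_left _ hl)
    | redClause C l _ _ _ h =>
      obtain ⟨m, hm, h⟩ := exists_clauseAt_of_mem_take h
      exact fun l hl => ih m hm h l (Finset.mem_union_left _ hl)
    | clInit C _ h => exact isKBVar_of_mem_kbMatrix ht h

/-- The literal is false under the assignment `s`. -/
def Lit.Falsified {V : Type*} (s : V → Bool) (l : Lit V) : Prop := l.sign ≠ s l.var

/-- For `a : ℕ → Bool`, the assignment with `x j = a j`, exactly one of `d j`, `e j` false such that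
`a j` is the only winning answer of the universal player, `d 0` false, and `f j` true. -/
def kbPlay (a : ℕ → Bool) : KBVar → Bool
  | d 0 => false
  | d (j + 1) => !a (j + 1)
  | e j => a j
  | x j => a j
  | f _ => true

/-- All existential literals of `C` have a position before that of `x i`. -/
def ExBefore (t i : ℕ) (C : Finset (Lit KBVar)) : Prop :=
  ∀ l ∈ C, kbQuant l.var = .ex → kbPos t l.var < 2 * i + 1

/-- All literals of `C` before `x i` are false under `kbPlay a`. -/
def FalsifiedBefore (t : ℕ) (a : ℕ → Bool) (i : ℕ) (C : Finset (Lit KBVar)) : Prop :=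
  ∀ l ∈ C, kbPos t l.var < 2 * i + 1 → l.Falsified (kbPlay a)

/-- `K` may be a premise of `C`, either of a resolution step on an existential pivot which, if it is
before `x i`, is false under `kbPlay a` in `K`, or of a reduction. -/
def KBStep (t : ℕ) (a : ℕ → Bool) (i : ℕ) (K C : Finset (Lit KBVar)) : Prop :=
  (∃ p : Lit KBVar, kbQuant p.var = .ex ∧
    (kbPos t p.var < 2 * i + 1 → p.Falsified (kbPlay a)) ∧ K ⊆ insert p C) ∨
  ∃ (l : Lit KBVar) (j : ℕ), l.var = x j ∧ ExBefore t j C ∧ K ⊆ insert l C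

/-- The ancestors of the `n`-th line with respect to `KBStep`. -/
inductive KBAncestor (t : ℕ) (a : ℕ → Bool) (π : List (Line KBVar)) (i n : ℕ) :
    ℕ → Finset (Lit KBVar) → Prop
  | refl {C : Finset (Lit KBVar)} : ClauseAt π n C → KBAncestor t a π i n n C
  | step {m k : ℕ} {C K : Finset (Lit KBVar)} : KBAncestor t a π i n m C → k < m →
      ClauseAt π k K → KBStep t a i K C → KBAncestor t a π i n k K

variable {t : ℕ} {a : ℕ → Bool} {π : List (Line KBVar)} {i n m k : ℕ}
  {C D K : Finset (Lit KBVar)}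

theorem KBAncestor.clauseAt (h : KBAncestor t a π i n m C) : ClauseAt π m C := by
  cases h <;> assumption

theorem KBAncestor.le (h : KBAncestor t a π i n m C) : m ≤ n := by
  induction h with
  | refl => exact le_rfl
  | step _ h _ _ ih => exact h.le.trans ih

theorem KBAncestor.trans (h : KBAncestor t a π i n m C) (h' : KBAncestor t a π i m k D) :
    KBAncestor t a π i n k D := by
  induction h' with
  | refl h' => exact h'.unique h.clauseAt ▸ h
  | step _ h₁ h₂ h₃ ih => exact .step ih h₁ h₂ h₃

/-- A larger level forces more pivots to follow the play, so fewer lines are ancestors. -/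
theorem KBAncestor.of_succ (h : KBAncestor t a π (i + 1) n m C) : KBAncestor t a π i n m C := by
  induction h with
  | refl h => exact .refl h
  | step _ h₁ h₂ h₃ ih =>
    refine .step ih h₁ h₂ (h₃.imp_left ?_)
    rintro ⟨p, hp, h, hK⟩
    exact ⟨p, hp, fun h' => h (by omega), hK⟩

theorem ExBefore.mono {j : ℕ} (h : ExBefore t j C) (hj : j ≤ i) : ExBefore t i C :=
  fun l hl hq => (h l hl hq).trans_le (by omega)

theorem KBAncestor.falsified_of_ex (hD : ClauseAt π n D)
    (hf : ∀ l ∈ D, kbQuant l.var = .ex → l.Falsified (kbPlay a))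
    (h : KBAncestor t a π i n m C) : ∀ l ∈ C, kbQuant l.var = .ex →
      kbPos t l.var < 2 * i + 1 → l.Falsified (kbPlay a) := by
  induction h with
  | refl h =>
    rw [h.unique hD]
    exact fun l hl hq _ => hf l hl hq
  | step _ _ _ h ih =>
    intro l hl hq hlt
    rcases h with ⟨p, _, hp, hK⟩ | ⟨r, j, hr, _, hK⟩
    · rcases Finset.mem_insert.1 (hK hl) with rfl | hl
      exacts [hp hlt, ih l hl hq hlt]
    · rcases Finset.mem_insert.1 (hK hl) with rfl | hl
      · rw [hr] at hq
        cases hq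
      · exact ih l hl hq hlt

/-- The `n`-th line of `π` is a clause whose existential literals are before `x i`, and all its
ancestors are false under `kbPlay a` as far as the variables before `x i` are concerned. -/
def IsCritical (t : ℕ) (a : ℕ → Bool) (π : List (Line KBVar)) (i n : ℕ) : Prop :=
  (∃ C, ClauseAt π n C ∧ ExBefore t i C) ∧
    ∀ m C, KBAncestor t a π i n m C → FalsifiedBefore t a i C

/-- Ancestors of an ancestor are ancestors, so such a line would itself be critical, against
minimality. -/
theorem IsCritical.eq_of_exBefore (hn : IsCritical t a π i n)
    (hmin : ∀ k < n, ¬ IsCritical t a π i k) (h : KBAncestor t a π i n m C)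
    (hC : ExBefore t i C) : m = n := by
  by_contra hne
  exact hmin m (lt_of_le_of_ne h.le hne)
    ⟨⟨C, h.clauseAt, hC⟩, fun k K hK => hn.2 k K (h.trans hK)⟩

/-- A literal of `x j` can disappear only by reduction. Then the existential literals of both
conclusion and premise precede `x i`, so minimality makes both of them line `n`, although the
premise comes strictly earlier. -/
theorem IsCritical.mem_of_mem_ancestor (hn : IsCritical t a π i n)
    (hmin : ∀ k < n, ¬ IsCritical t a π i k) (hD : ClauseAt π n D)
    (h : KBAncestor t a π i n m C) {l : Lit KBVar} {j : ℕ} (hj : j ≤ i) (hl : l.var = x j)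
    (hlC : l ∈ C) : l ∈ D := by
  induction h with
  | refl h => exact h.unique hD ▸ hlC
  | step hm hk hK h ih =>
    rename_i m k C K
    refine ih ?_
    rcases h with ⟨p, hp, -, hKp⟩ | ⟨r, j', hr, hC, hKr⟩
    · rcases Finset.mem_insert.1 (hKp hlC) with rfl | h
      · rw [hl] at hp
        cases hp
      · exact h
    · rcases Finset.mem_insert.1 (hKr hlC) with rfl | h
      · exfalso
        obtain rfl : j' = j := by
          rw [hl] at hr
          cases hr
          rfl
        have hCi := hC.mono hj
        have hKi : ExBefore t i K := by
          intro l' hl' hq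
          rcases Finset.mem_insert.1 (hKr hl') with rfl | h'
          · rw [hl] at hq
            cases hq
          · exact hCi l' h' hq
        have e₁ := hn.eq_of_exBefore hmin hm hCi
        have e₂ := hn.eq_of_exBefore hmin
          (.step hm hk hK (.inr ⟨l, j', hl, hC, hKr⟩)) hKi
        omega
      · exact h

/-- Soundness along the ancestors: of two resolution premises, the one whose pivot literal is false
under `s` is an ancestor and passes its true existential literal on; reduction does not touch
existential literals. -/
theorem KBAncestor.exists_true_of_axioms (ht : 1 ≤ t) (hπ : IsDerivation (QRES (kb t)) π)
    {s : KBVar → Bool}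
    (hs : ∀ v, kbQuant v = .ex → kbPos t v < 2 * i + 1 → s v = kbPlay a v)
    (hax : ∀ m C, KBAncestor t a π i n m C → C ∈ kbMatrix t →
      ∃ l ∈ C, kbQuant l.var = .ex ∧ ¬ l.Falsified s)
    (h : KBAncestor t a π i n m C) : ∃ l ∈ C, kbQuant l.var = .ex ∧ ¬ l.Falsified s := by
  induction m using Nat.strong_induction_on generalizing C with
  | _ m ih =>
    have key : ∀ (p : Lit KBVar) (K : Finset (Lit KBVar)), kbQuant p.var = .ex → p.Falsified s →
        K ⊆ insert p C → Line.clause K ∈ π.take m →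
        ∃ l ∈ C, kbQuant l.var = .ex ∧ ¬ l.Falsified s := by
      intro p K hq hp hK hmem
      obtain ⟨k, hk, hKk⟩ := exists_clauseAt_of_mem_take hmem
      obtain ⟨l, hl, hlq, hls⟩ := ih k hk (.step h hk hKk
        (.inl ⟨p, hq, fun hlt => by rwa [Lit.Falsified, ← hs _ hq hlt], hK⟩))
      rcases Finset.mem_insert.1 (hK hl) with rfl | hl
      exacts [absurd hp hls, ⟨l, hl, hlq, hls⟩]
    cases h.clauseAt.rule hπ with
    | resClause C₁ C₂ p _ _ _ hq h₁ h₂ =>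
      have hq := ((kb_hasQuant_iff ht _ _).1 hq).2
      by_cases hp : p.Falsified s
      · exact key p _ hq hp (by grind) h₁
      · refine key p.compl _ hq ?_ (by grind) h₂
        simpa [Lit.Falsified, Lit.compl] using hp
    | redClause C l _ hq hb h₁ =>
      obtain ⟨k, hk, hK⟩ := exists_clauseAt_of_mem_take h₁
      have hq := ((kb_hasQuant_iff ht _ _).1 hq).2
      obtain ⟨j, hj⟩ : ∃ j, l.var = x j := by
        cases hv : l.var <;> simp_all [kbQuant]
      have hC : ExBefore t j C := by
        intro l' hl' hq'
        have hx := hb l' hl' ((kb_hasQuant_iff ht _ _).2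
          ⟨h.clauseAt.isKBVar ht hπ l' hl', hq'⟩)
        rw [hj] at hx
        exact kbPos_lt_of_before ht hx hq'
      obtain ⟨l', hl', hlq, hls⟩ := ih k hk (.step h hk hK (.inr ⟨l, j, hj, hC, by grind⟩))
      rcases Finset.mem_union.1 hl' with hl' | hl'
      · exact ⟨l', hl', hlq, hls⟩
      · rw [Finset.mem_singleton.1 hl', hq] at hlq
        cases hlq
    | clInit C _ hm => exact hax _ _ h hm

/-- The play falsifies all existential literals of a critical clause, however it is continued after
`x i`, so some axiom among its ancestors must be falsified existentially too. The continuation `s`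
is free and selects the axiom. -/
theorem IsCritical.exists_axiom (ht : 1 ≤ t) (hπ : IsDerivation (QRES (kb t)) π)
    (hn : IsCritical t a π i n) {s : KBVar → Bool}
    (hs : ∀ v, kbQuant v = .ex → kbPos t v < 2 * i + 1 → s v = kbPlay a v) :
    ∃ m C, KBAncestor t a π i n m C ∧ C ∈ kbMatrix t ∧
      ∀ l ∈ C, kbQuant l.var = .ex → l.Falsified s := by
  by_contra! hcon
  obtain ⟨⟨C, hC, hb⟩, hf⟩ := hn
  obtain ⟨l, hl, hq, hls⟩ := KBAncestor.exists_true_of_axioms ht hπ hs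
    (fun m C h₁ h₂ => hcon m C h₁ h₂) (.refl hC)
  have hlt := hb l hl hq
  refine hls ?_
  rw [Lit.Falsified, hs _ hq hlt]
  exact hf n C (.refl hC) l hl hlt

theorem kbPlay_d {j : ℕ} (hj : 1 ≤ j) : kbPlay a (d j) = !a j := by
  obtain ⟨j, rfl⟩ : ∃ k, j = k + 1 := ⟨j - 1, by omega⟩
  rfl

/-- A clause of the matrix whose existential literals are all false when `kbPlay a` is played on
the variables before `x i` and all later existential variables are true contains the literal of
`x i` that is false under `a`. -/
theorem mem_axiom_of_falsified (hi : 1 ≤ i) (hit : i ≤ t) (hC : C ∈ kbMatrix t)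
    (h : ∀ l ∈ C, kbQuant l.var = .ex →
      l.Falsified fun v => if kbPos t v < 2 * i + 1 then kbPlay a v else true) :
    (⟨x i, !a i⟩ : Lit KBVar) ∈ C := by
  have low : ∀ l ∈ C, kbQuant l.var = .ex → kbPos t l.var < 2 * i + 1 →
      l.sign ≠ kbPlay a l.var := by
    intro l hl hq hlt
    simpa [Lit.Falsified, hlt] using h l hl hq
  have high : ∀ l ∈ C, kbQuant l.var = .ex → 2 * i + 1 ≤ kbPos t l.var → l.sign = false := by
    intro l hl hq hlt
    simpa [Lit.Falsified, hlt.not_gt] using h l hl hq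
  -- The play makes one of `d j`, `e j` false, which rules out the axioms of levels below `i`.
  have hde : ∀ j, 1 ≤ j → j ≤ i → neg (d j) ∈ C → neg (e j) ∈ C → False := by
    intro j hj hji h₁ h₂
    have h₁ := low _ h₁ rfl (by simp only [neg, kbPos]; omega)
    have h₂ := low _ h₂ rfl (by simp only [neg, kbPos]; omega)
    simp [neg, kbPlay_d hj] at h₁
    simp [neg, kbPlay, h₁] at h₂
  have hx : ∀ j v, 1 ≤ j → (v = d j ∧ neg (x j) ∈ C ∨ v = e j ∧ pos (x j) ∈ C) →
      (j < i → False) → pos v ∈ C → (⟨x i, !a i⟩ : Lit KBVar) ∈ C := by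
    intro j v hj hv hji hvC
    rcases Nat.lt_trichotomy j i with hlt | rfl | hlt
    · exact (hji hlt).elim
    · rcases hv with ⟨rfl, hv⟩ | ⟨rfl, hv⟩
      · have := low _ hvC rfl (by simp only [pos, kbPos]; omega)
        simp [pos, kbPlay_d hj] at this
        rwa [this]
      · have := low _ hvC rfl (by simp only [pos, kbPos]; omega)
        simp [pos, kbPlay] at this
        rwa [this]
    · rcases hv with ⟨rfl, -⟩ | ⟨rfl, -⟩ <;>
      · have := high _ hvC rfl (by simp only [pos, kbPos]; omega)
        simp [pos] at this
  have hf : ∀ j, pos (f j) ∉ C := by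
    intro j hj
    have := high _ hj rfl (by simp only [pos, kbPos]; omega)
    simp [pos] at this
  rcases mem_kbMatrix_iff.1 hC with hC | hC | ⟨j, h₁, h₂, hC⟩ | ⟨j, h₁, h₂, hC⟩ | hC |
    hC | ⟨j, h₁, h₂, hC⟩ | ⟨j, h₁, h₂, hC⟩
  · have := low (neg (d 0)) (by simp [hC]) rfl (by simp only [neg, kbPos]; omega)
    simp [neg, kbPlay] at this
  · exact (hde 1 le_rfl hi (by simp [hC]) (by simp [hC])).elim
  · exact hx j (d j) h₁ (.inl ⟨rfl, by simp [hC]⟩)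
      (fun hji => hde (j + 1) (by omega) hji (by simp [hC]) (by simp [hC])) (by simp [hC])
  · exact hx j (e j) h₁ (.inr ⟨rfl, by simp [hC]⟩)
      (fun hji => hde (j + 1) (by omega) hji (by simp [hC]) (by simp [hC])) (by simp [hC])
  · exact hx t (d t) (hi.trans hit) (.inl ⟨rfl, by simp [hC]⟩) (fun h => by omega) (by simp [hC])
  · exact hx t (e t) (hi.trans hit) (.inr ⟨rfl, by simp [hC]⟩) (fun h => by omega) (by simp [hC])
  · exact (hf j (by simp [hC])).elim
  · exact (hf j (by simp [hC])).elim

/-- A clause of the matrix whose existential literals are all false under `kbPlay a` modified by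
making `f i` false contains a literal of `x i`. -/
theorem exists_mem_axiom_of_falsified (hi : 1 ≤ i) (hit : i ≤ t) (hC : C ∈ kbMatrix t)
    (h : ∀ l ∈ C, kbQuant l.var = .ex → l.Falsified (Function.update (kbPlay a) (f i) false)) :
    ∃ b, (⟨x i, b⟩ : Lit KBVar) ∈ C := by
  have low : ∀ l ∈ C, kbQuant l.var = .ex → l.var ≠ f i → l.sign ≠ kbPlay a l.var := by
    intro l hl hq hne
    simpa [Lit.Falsified, hne] using h l hl hq
  have hde : ∀ j, 1 ≤ j → neg (d j) ∈ C → neg (e j) ∈ C → False := by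
    intro j hj h₁ h₂
    have h₁ := low _ h₁ rfl (by simp [neg])
    have h₂ := low _ h₂ rfl (by simp [neg])
    simp [neg, kbPlay_d hj] at h₁
    simp [neg, kbPlay, h₁] at h₂
  have hf : neg (f i) ∉ C := by
    intro hf
    have := h _ hf rfl
    simp [Lit.Falsified, neg] at this
  have hf' : ∀ j, pos (f j) ∈ C → j = i := by
    intro j hj
    by_contra hne
    have := low _ hj rfl (by simpa [pos] using hne)
    simp [pos, kbPlay] at this
  rcases mem_kbMatrix_iff.1 hC with hC | hC | ⟨j, h₁, h₂, hC⟩ | ⟨j, h₁, h₂, hC⟩ | hC |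
    hC | ⟨j, h₁, h₂, hC⟩ | ⟨j, h₁, h₂, hC⟩
  · have := low (neg (d 0)) (by simp [hC]) rfl (by simp [neg])
    simp [neg, kbPlay] at this
  · exact (hde 1 le_rfl (by simp [hC]) (by simp [hC])).elim
  · exact (hde (j + 1) (by omega) (by simp [hC]) (by simp [hC])).elim
  · exact (hde (j + 1) (by omega) (by simp [hC]) (by simp [hC])).elim
  · refine (hf ?_).elim
    rw [hC]
    exact Finset.mem_union_right _ (Finset.mem_image_of_mem _ (Finset.mem_Icc.2 ⟨hi, hit⟩))
  · refine (hf ?_).elim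
    rw [hC]
    exact Finset.mem_union_right _ (Finset.mem_image_of_mem _ (Finset.mem_Icc.2 ⟨hi, hit⟩))
  · obtain rfl := hf' j (by simp [hC])
    exact ⟨true, by simp [hC, pos]⟩
  · obtain rfl := hf' j (by simp [hC])
    exact ⟨false, by simp [hC, neg]⟩

theorem NonTaut.sign_eq {V : Type*} {C : Finset (Lit V)} (h : NonTaut C) {v : V} {b c : Bool}
    (hb : (⟨v, b⟩ : Lit V) ∈ C) (hc : (⟨v, c⟩ : Lit V) ∈ C) : b = c := by
  cases b <;> cases c
  · rfl
  · exact (h v ⟨hc, hb⟩).elim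
  · exact (h v ⟨hb, hc⟩).elim
  · rfl

theorem IsCritical.mem_of_minimal (hi : 1 ≤ i) (hit : i ≤ t)
    (hπ : IsDerivation (QRES (kb t)) π) (hn : IsCritical t a π i n)
    (hmin : ∀ k < n, ¬ IsCritical t a π i k) (hD : ClauseAt π n D) :
    (⟨x i, !a i⟩ : Lit KBVar) ∈ D := by
  obtain ⟨m, C, h₁, h₂, h₃⟩ := hn.exists_axiom (hi.trans hit) hπ
    (s := fun v => if kbPos t v < 2 * i + 1 then kbPlay a v else true)
    (fun v _ hv => if_pos hv)
  exact hn.mem_of_mem_ancestor hmin hD h₁ le_rfl rfl (mem_axiom_of_falsified hi hit h₂ h₃)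

/-- The new variables are `x i` and the existentials between it and `x (i + 1)`. The latter occur in
ancestors only as pivots, followed on their false side. A literal of `x i` in an ancestor persists
to line `n`, where non-tautology forces the sign that is false under `a`. -/
theorem IsCritical.succ (hi : 1 ≤ i) (hit : i ≤ t)
    (hπ : IsDerivation (QRES (kb t)) π) (hn : IsCritical t a π i n)
    (hmin : ∀ k < n, ¬ IsCritical t a π i k) : IsCritical t a π (i + 1) n := by
  obtain ⟨D, hD, hDi⟩ := hn.1
  refine ⟨⟨D, hD, hDi.mono (Nat.le_succ i)⟩, fun m C h l hl hlt => ?_⟩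
  by_cases hq : kbQuant l.var = .ex
  · exact h.falsified_of_ex hD
      (fun l hl hq => hn.2 n D (.refl hD) l hl (hDi l hl hq)) l hl hq hlt
  · obtain ⟨v, b⟩ := l
    obtain ⟨j, rfl⟩ : ∃ j, v = x j := by
      cases v <;> simp_all [kbQuant]
    simp only [kbPos] at hlt
    have hb : b = !a j := by
      rcases Nat.lt_or_ge j i with hj | hj
      · have := hn.2 m C h.of_succ _ hl (by simp only [kbPos]; omega)
        exact Bool.eq_not.2 this
      · obtain rfl : j = i := by omega
        exact (hD.nonTaut hπ).sign_eq (hn.mem_of_mem_ancestor hmin hD h.of_succ le_rfl rfl hl)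
          (hn.mem_of_minimal hi hit hπ hmin hD)
    simp [Lit.Falsified, kbPlay, hb]

theorem exists_isCritical (hπ : IsRefutation (QRES (kb t)) π) (a : ℕ → Bool) (hi : 1 ≤ i)
    (hit : i ≤ t) : ∃ n, IsCritical t a π i n ∧ ∀ k < n, ¬ IsCritical t a π i k := by
  classical
  suffices h : ∃ n, IsCritical t a π i n from
    ⟨Nat.find h, Nat.find_spec h, fun k hk => Nat.find_min h hk⟩
  induction i, hi using Nat.le_induction with
  | base =>
    obtain ⟨n, hn, he⟩ := List.getElem_of_mem hπ.2
    have hn : ClauseAt π n ∅ := List.getElem?_eq_some_iff.2 ⟨hn, he⟩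
    refine ⟨n, ⟨∅, hn, by simp [ExBefore]⟩, fun m C h l hl hlt => ?_⟩
    by_cases hq : kbQuant l.var = .ex
    · exact h.falsified_of_ex hn (by simp) l hl hq hlt
    -- The only universal position below 3 belongs to `x 0`, which is not a variable of the formula.
    · have hv := h.clauseAt.isKBVar hit hπ.1 l hl
      cases hl : l.var <;> simp_all [kbQuant, IsKBVar, kbPos]
      omega
  | succ i hi ih =>
    have h := ih (by omega)
    exact ⟨Nat.find h, (Nat.find_spec h).succ hi (by omega) hπ.1 fun k hk => Nat.find_min h hk⟩

/-- For every strategy `a` of the universal variables, a refutation of `kb t` contains a clause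
with all the literals of `x 1, …, x t` that are false under `a`. -/
theorem exists_clauseAt_forall_mem (ht : 1 ≤ t) (hπ : IsRefutation (QRES (kb t)) π)
    (a : ℕ → Bool) :
    ∃ n C, ClauseAt π n C ∧ ∀ j, 1 ≤ j → j ≤ t → (⟨x j, !a j⟩ : Lit KBVar) ∈ C := by
  obtain ⟨n, hn, hmin⟩ := exists_isCritical hπ a ht le_rfl
  obtain ⟨D, hD, -⟩ := hn.1
  refine ⟨n, D, hD, fun j hj hjt => ?_⟩
  rcases Nat.eq_or_lt_of_le hjt with rfl | hlt
  · exact hn.mem_of_minimal ht le_rfl hπ.1 hmin hD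
  -- All `f`-variables come after `x t`, so `f j` may be flipped; the falsified axiom is then `x j ∨
  -- f j` or `¬x j ∨ f j`.
  · obtain ⟨m, C, h₁, h₂, h₃⟩ := hn.exists_axiom ht hπ.1
      (s := Function.update (kbPlay a) (f j) false) (by
        intro v _ hv
        refine Function.update_of_ne ?_ _ _
        rintro rfl
        simp only [kbPos] at hv
        omega)
    obtain ⟨b, hb⟩ := exists_mem_axiom_of_falsified hj hjt h₂ h₃
    have := hn.2 m C h₁ _ hb (by simp only [kbPos]; omega)
    obtain rfl : b = !a j := Bool.eq_not.2 this
    exact hn.mem_of_mem_ancestor hmin hD h₁ hjt rfl hb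

theorem two_pow_le_length (ht : 1 ≤ t) (hπ : IsRefutation (QRES (kb t)) π) :
    2 ^ t ≤ π.length := by
  -- Index shift from `0, …, t - 1` to `1, …, t`; the values outside this range are irrelevant.
  let ext : (Fin t → Bool) → ℕ → Bool :=
    fun a j => if h : j - 1 < t then a ⟨j - 1, h⟩ else false
  choose n C hC hmem using fun a => exists_clauseAt_forall_mem ht hπ (ext a)
  have hlt : ∀ a, n a < π.length := fun a => (List.getElem?_eq_some_iff.1 (hC a)).1
  have hinj : Function.Injective fun a => (⟨n a, hlt a⟩ : Fin π.length) := by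
    intro a b hab
    have hn : n a = n b := congrArg Fin.val hab
    have hCC : C a = C b := (hC a).unique (hn ▸ hC b)
    funext j
    have h₁ := hmem a (j + 1) (by omega) j.isLt
    have h₂ := hmem b (j + 1) (by omega) j.isLt
    have := ((hC b).nonTaut hπ.1).sign_eq (hCC ▸ h₁) h₂
    simpa [ext] using this
  simpa using Fintype.card_le_of_injective _ hinj

end LowerBound

end QBF

theorem mainTheorem5 :
    (∀ {V : Type*} [DecidableEq V] (φ : QBF.PCNF V) (π : List (QBF.Line V)),
      QBF.IsRefutation (QBF.QRES φ) π → QBF.IsRefutation (QBF.QRESAbs φ) π) ∧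
    (∃ p : Polynomial ℕ, ∀ t : ℕ, 1 ≤ t → ∃ π : List (QBF.Line QBF.KBVar),
      QBF.IsRefutation (QBF.QRESAbs (QBF.kb t)) π ∧
      QBF.IsDerivation (fun P L => QBF.QRES (QBF.kb t) P L ∨
        ∃ A, QBF.AbsClInit (QBF.kb t) A L ∧
          QBF.HasComplementaryUnits ((QBF.kb t).eabs.assign A)) π ∧
      QBF.totalSize π ≤ p.eval t) ∧
    (∃ c : ℝ, 1 < c ∧ ∀ t : ℕ, 1 ≤ t → ∀ π : List (QBF.Line QBF.KBVar),
      QBF.IsRefutation (QBF.QRES (QBF.kb t)) π → c ^ t ≤ (π.length : ℝ)) := by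
  refine ⟨fun φ π hπ => ⟨hπ.1.mono_rules fun P L => Or.inl, hπ.2⟩,
    ⟨100 * Polynomial.X ^ 2, fun t ht => ?_⟩, 2, one_lt_two, fun t ht π hπ => ?_⟩
  · obtain ⟨π, h₁, h₂, h₃⟩ := QBF.derivableWithin_empty_clause ht
    refine ⟨π, ⟨h₁.mono_rules fun P L => Or.imp_right ?_, h₂ _ rfl⟩, h₁, by simpa using h₃⟩
    rintro ⟨A, hA, -⟩
    exact ⟨A, hA⟩
  · exact_mod_cast QBF.two_pow_le_length ht hπ
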